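/- A red/blue/purple colouring of the complete graph $K_n$ is a partition of its edge set into three (possibly empty) graphs $R, B, P$. For real $s,t>0$, let $g(n;s,t)$ denote the largest integer $g$ for which there is a red/blue/purple colouring of $K_n$ with $|P|=g$ such that $R\cup P$ contains no clique on $\lceil s\rceil$ vertices and $B\cup P$ contains no clique on $\lceil t\rceil$ vertices; it is defined whenever at least one such colouring exists. **Theorem.** Let $\ell\ge 1$ be an integer and let $0<c<\frac{1}{3\ell}$ be a real constant. Then $g(n;2\ell+1,cn)$ is defined for all sufficiently large $n$, and, as $n\to\infty$ with $\ell$ and $c$ fixed, $$g(n;2\ell+1,cn)\;\ge\;\left(\frac{\ell-1}{\ell}+c+o(1)\right)\frac{n^2}{2}.$$ -/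

import Mathlib

open Filter Topology

/-- A red/blue/purple colouring of the complete graph on `V`: a partition of its edges into
three graphs (colour classes may be empty). -/
structure RBPColouring (V : Type*) where
  red : SimpleGraph V
  blue : SimpleGraph V
  purple : SimpleGraph V
  disjoint_red_blue : Disjoint red blue
  disjoint_red_purple : Disjoint red purple
  disjoint_blue_purple : Disjoint blue purple
  cover : red ⊔ blue ⊔ purple = ⊤

/-- The colouring is `(s,t)`-free: the red/purple graph contains no `K_s` and the blue/purple graph
contains no `K_t`. -/
def RBPColouring.IsFree {V : Type*} (C : RBPColouring V) (s t : ℕ) : Prop :=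
  (C.purple ⊔ C.red).CliqueFree s ∧ (C.purple ⊔ C.blue).CliqueFree t

/-- The possible numbers of purple edges in an `(s,t)`-free red/blue/purple colouring of `K_n`,
where real parameters `s`, `t` are rounded up. -/
def purpleCounts (n : ℕ) (s t : ℝ) : Set ℕ :=
  {m | ∃ C : RBPColouring (Fin n), C.IsFree ⌈s⌉₊ ⌈t⌉₊ ∧ C.purple.edgeSet.ncard = m}

/-- `g(n;s,t)`: the largest number of purple edges in an `(s,t)`-free red/blue/purple colouring of
`K_n`. It is meaningful only when such a colouring exists; otherwise the value is `0`. -/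
noncomputable def purpleRamsey (n : ℕ) (s t : ℝ) : ℕ :=
  sSup (purpleCounts n s t)

/-
The colouring is a balanced blow-up of a fixed template, with all pairs inside a class blue. A
vertex of the template is a point of one of `ℓ` long cycles together with a point of a discrete
cube. Pairs whose cube points are nearly antipodal are red when their cycle points are far apart or
lie in different cycles; pairs whose cube points are neither nearly antipodal nor close are purple
when their cycle points are nearly antipodal or lie in different cycles.

Over a single cycle, two edges of a red/purple triangle would have the same colour; but two nearly
antipodal steps, in the cube for red and in the cycle for purple, return close to the start, which
no red or purple edge does. So a red/purple clique has at most two vertices over each cycle.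

By Poincaré's inequality on the cube, any two sets of positive density span a nearly antipodal
pair. Hence, up to a small error, a set without red edges lives over cycle points of which no two
are far apart, and so has density at most about `c`. For the same reason almost all pairs of cube
points are available to purple, which gives purple degrees of density about `(ℓ - 1) / ℓ + c`.
-/

open scoped Finset FinsetFamily

section DiscreteCube

theorem hammingDist_add_hammingDist_compl {ι : Type*} [Fintype ι] (x y : ι → Bool) :
    hammingDist x y + hammingDist x yᶜ = Fintype.card ι := by
  have hne (i : ι) : x i ≠ yᶜ i ↔ ¬ x i ≠ y i := by
    rw [Pi.compl_apply]
    cases x i <;> cases y i <;> decide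
  simp only [hammingDist, hne]
  exact Finset.card_filter_add_card_filter_not _

theorem sum_cube_succ {N : ℕ} (f : (Fin (N + 1) → Bool) → ℝ) :
    ∑ x, f x = ∑ x, f (Fin.cons false x) + ∑ x, f (Fin.cons true x) := by
  rw [← (Fin.consEquiv fun _ : Fin (N + 1) => Bool).sum_comp, Fintype.sum_prod_type,
    Fintype.sum_bool, add_comm]
  rfl

theorem hammingDist_cons {N : ℕ} {α : Type*} [DecidableEq α] (a b : α) (x y : Fin N → α) :
    hammingDist (Fin.cons a x : Fin (N + 1) → α) (Fin.cons b y) =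
      (if a ≠ b then 1 else 0) + hammingDist x y := by
  simp only [hammingDist, Fin.card_filter_univ_succ, Fin.cons_zero, Fin.cons_succ]
  split_ifs <;> omega

-- Poincaré's inequality on the cube. Splitting off a coordinate, the variance of `f` is the mean
-- of the variances of the two halves plus a quarter of the squared difference of their means.
theorem variance_le_of_abs_sub_le_hammingDist {N : ℕ} (f : (Fin N → Bool) → ℝ)
    (hf : ∀ x y, |f x - f y| ≤ hammingDist x y) :
    2 ^ N * ∑ x, f x ^ 2 - (∑ x, f x) ^ 2 ≤ N / 4 * 4 ^ N := by
  induction N with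
  | zero => simp
  | succ N ih =>
    have half (b : Bool) := ih (fun x => f (Fin.cons b x)) fun x y => by
      simpa [hammingDist_cons] using hf (Fin.cons b x) (Fin.cons b y)
    have abs_sum_sub_le :
        |∑ x : Fin N → Bool, f (Fin.cons false x) - ∑ x, f (Fin.cons true x)| ≤ 2 ^ N := by
      rw [← Finset.sum_sub_distrib]
      refine (Finset.abs_sum_le_sum_abs _ _).trans
        ((Finset.sum_le_card_nsmul _ _ 1 fun x _ => ?_).trans (by simp))
      simpa [hammingDist_cons] using hf (Fin.cons false x) (Fin.cons true x)
    have sq_sum_sub_le :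
        (∑ x : Fin N → Bool, f (Fin.cons false x) - ∑ x, f (Fin.cons true x)) ^ 2 ≤ 4 ^ N := by
      rw [show (4 : ℝ) ^ N = (2 ^ N) ^ 2 by rw [pow_right_comm]; norm_num]
      exact sq_le_sq.mpr (abs_sum_sub_le.trans (le_abs_self _))
    rw [sum_cube_succ f, sum_cube_succ fun x => f x ^ 2, pow_succ (2 : ℝ), pow_succ (4 : ℝ)]
    push_cast
    linarith [half false, half true]

theorem sum_sum_sub_sq {α : Type*} [Fintype α] (f : α → ℝ) :
    ∑ x, ∑ y, (f x - f y) ^ 2 = 2 * (Fintype.card α * ∑ x, f x ^ 2 - (∑ x, f x) ^ 2) := by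
  simp only [sub_sq, Finset.sum_add_distrib, Finset.sum_sub_distrib, Finset.sum_const,
    Finset.card_univ, nsmul_eq_mul, ← Finset.mul_sum, ← Finset.sum_mul]
  ring

theorem card_mul_card_mul_sq_le {N : ℕ} (f : (Fin N → Bool) → ℝ)
    (hf : ∀ x y, |f x - f y| ≤ hammingDist x y) (A B : Finset (Fin N → Bool)) {d : ℝ}
    (hd : 0 ≤ d) (hAB : ∀ a ∈ A, ∀ b ∈ B, d ≤ |f a - f b|) :
    2 * (#A * #B * d ^ 2) ≤ N * 4 ^ N := by
  have pairs : #A * #B * d ^ 2 ≤ ∑ x, ∑ y, (f x - f y) ^ 2 := by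
    calc (#A * #B * d ^ 2 : ℝ) = ∑ _a ∈ A, ∑ _b ∈ B, d ^ 2 := by simp [mul_assoc]
      _ ≤ ∑ a ∈ A, ∑ b ∈ B, (f a - f b) ^ 2 := by
          refine Finset.sum_le_sum fun a ha => Finset.sum_le_sum fun b hb => ?_
          rw [← sq_abs (f a - f b)]
          gcongr
          exact hAB a ha b hb
      _ ≤ ∑ a ∈ A, ∑ y, (f a - f y) ^ 2 := by
          gcongr
          exact Finset.subset_univ B
      _ ≤ ∑ x, ∑ y, (f x - f y) ^ 2 := by
          gcongr
          exact Finset.subset_univ A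
  rw [sum_sum_sub_sq] at pairs
  have := variance_le_of_abs_sub_le_hammingDist f hf
  simp only [Fintype.card_pi, Fintype.card_bool, Finset.prod_const, Finset.card_univ,
    Fintype.card_fin, Nat.cast_pow, Nat.cast_ofNat] at pairs
  linarith

-- Apply the previous bound to the distance to `A`, which vanishes on `A` and is at least `t` on the
-- antipodes of `B`.
theorem card_mul_card_mul_sq_le_of_hammingDist_add_le {N t : ℕ} {A B : Finset (Fin N → Bool)}
    (hAB : ∀ a ∈ A, ∀ b ∈ B, hammingDist a b + t ≤ N) :
    2 * (#A * #B * (t : ℝ) ^ 2) ≤ N * 4 ^ N := by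
  rcases A.eq_empty_or_nonempty with rfl | hA
  · simp only [Finset.card_empty, Nat.cast_zero, zero_mul, mul_zero]
    positivity
  let f (x : Fin N → Bool) : ℝ :=
    Metric.infDist (Hamming.toHamming x) (Hamming.toHamming '' (A : Set (Fin N → Bool)))
  have lipschitz (x y) : |f x - f y| ≤ hammingDist x y :=
    (Metric.lipschitz_infDist_pt _).dist_le_mul _ _ |>.trans_eq <| by simp
  have far (a) (ha : a ∈ A) (b) (hb : b ∈ Bᶜˢ) : (t : ℝ) ≤ |f a - f b| := by
    have fa : f a = 0 := Metric.infDist_zero_of_mem ⟨a, ha, rfl⟩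
    have fb : (t : ℝ) ≤ f b := by
      refine (Metric.le_infDist (hA.to_set.image _)).mpr ?_
      rintro _ ⟨a', ha', rfl⟩
      have near := hAB a' ha' bᶜ (Finset.mem_compls.mp hb)
      have compl := hammingDist_add_hammingDist_compl a' b
      rw [Fintype.card_fin] at compl
      rw [dist_comm, Hamming.dist_eq_hammingDist, Nat.cast_le]
      simp only [Hamming.ofHamming_toHamming]
      omega
    rw [fa, zero_sub, abs_neg]
    exact fb.trans (le_abs_self _)
  simpa using card_mul_card_mul_sq_le f lipschitz A Bᶜˢ t.cast_nonneg far

/-- Any two sets containing at least the proportion `ε` of all vertices, possibly equal or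
overlapping, are joined by an edge. -/
def JoinsDenseSets {V : Type*} [Fintype V] (G : SimpleGraph V) (ε : ℝ) : Prop :=
  ∀ A B : Finset V, ε * Fintype.card V ≤ #A → ε * Fintype.card V ≤ #B →
    ∃ a ∈ A, ∃ b ∈ B, G.Adj a b

/-- The graph on the discrete cube whose edges join points at distance less than `t` from being
antipodal. -/
def nearlyAntipodalGraph (N t : ℕ) : SimpleGraph (Fin N → Bool) where
  Adj x y := x ≠ y ∧ N < hammingDist x y + t
  symm := ⟨fun x y h => ⟨h.1.symm, hammingDist_comm x y ▸ h.2⟩⟩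
  loopless := ⟨fun _ h => h.1 rfl⟩

/-- The graph on the discrete cube whose edges join points that are neither nearly antipodal, as in
`nearlyAntipodalGraph`, nor within distance less than `2 * t`. -/
def middleGraph (N t : ℕ) : SimpleGraph (Fin N → Bool) where
  Adj x y := x ≠ y ∧ 2 * t ≤ hammingDist x y ∧ hammingDist x y + t ≤ N
  symm := ⟨fun x y h => ⟨h.1.symm, hammingDist_comm x y ▸ h.2⟩⟩
  loopless := ⟨fun _ h => h.1 rfl⟩

theorem disjoint_nearlyAntipodalGraph_middleGraph (N t : ℕ) :
    Disjoint (nearlyAntipodalGraph N t) (middleGraph N t) := by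
  rw [disjoint_iff_inf_le]
  rintro x y ⟨antipodal, middle⟩
  exact antipodal.2.not_ge middle.2.2

theorem not_adj_of_nearlyAntipodalGraph_adj {N t : ℕ} (ht : 3 * t ≤ N) {x y z : Fin N → Bool}
    (hxy : (nearlyAntipodalGraph N t).Adj x y) (hyz : (nearlyAntipodalGraph N t).Adj y z) :
    ¬ (nearlyAntipodalGraph N t ⊔ middleGraph N t).Adj x z := by
  have close : hammingDist x z < 2 * t := by
    have hx := hammingDist_add_hammingDist_compl x y
    have hz := hammingDist_add_hammingDist_compl z y
    have triangle := hammingDist_triangle_right x z yᶜ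
    have hxy' := hxy.2
    have hyz' := hammingDist_comm y z ▸ hyz.2
    rw [Fintype.card_fin] at hx hz
    omega
  rintro (antipodal | middle)
  · have := antipodal.2
    omega
  · exact close.not_ge middle.2.1

theorem joinsDenseSets_nearlyAntipodalGraph {N t : ℕ} (ht : t ≤ N) {ε : ℝ} (hε : 0 ≤ ε)
    (hN : N < 2 * (ε * t) ^ 2) : JoinsDenseSets (nearlyAntipodalGraph N t) ε := by
  intro A B hA hB
  simp only [Fintype.card_pi, Fintype.card_bool, Finset.prod_const, Finset.card_univ,
    Fintype.card_fin, Nat.cast_pow, Nat.cast_ofNat] at hA hB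
  have large : (N : ℝ) * 4 ^ N < 2 * (#A * #B * (t : ℝ) ^ 2) :=
    calc (N : ℝ) * 4 ^ N < 2 * (ε * t) ^ 2 * 4 ^ N := by gcongr
      _ = 2 * ((ε * 2 ^ N) * (ε * 2 ^ N) * (t : ℝ) ^ 2) := by
          rw [show (4 : ℝ) ^ N = 2 ^ N * 2 ^ N by rw [← mul_pow]; norm_num]
          ring
      _ ≤ 2 * (#A * #B * (t : ℝ) ^ 2) := by gcongr
  contrapose! large
  refine card_mul_card_mul_sq_le_of_hammingDist_add_le fun a ha b hb => ?_
  by_contra! far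
  refine large a ha b hb ⟨?_, far⟩
  rintro rfl
  rw [hammingDist_self] at far
  omega

-- The points near `x`, and likewise the points nearly antipodal to `x`, are too close to one
-- another to span a nearly antipodal pair, so neither set is dense.
theorem le_ncard_neighborSet_middleGraph {N t : ℕ} (ht₀ : 0 < t) (ht : 5 * t ≤ N) {ε : ℝ}
    (hε : JoinsDenseSets (nearlyAntipodalGraph N t) ε) (x : Fin N → Bool) :
    (1 - 2 * ε) * 2 ^ N ≤ ((middleGraph N t).neighborSet x).ncard := by
  have sparse (A : Finset (Fin N → Bool)) (hA : ∀ a ∈ A, ∀ b ∈ A, hammingDist a b + t ≤ N) :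
      (#A : ℝ) < ε * 2 ^ N := by
    by_contra! dense
    obtain ⟨a, ha, b, hb, hab⟩ := hε A A (by simpa using dense) (by simpa using dense)
    exact hab.2.not_ge (hA a ha b hb)
  let near : Finset (Fin N → Bool) := {y | hammingDist x y < 2 * t}
  let antipodal : Finset (Fin N → Bool) := {y | N < hammingDist x y + t}
  have near_sparse := sparse near fun a ha b hb => by
    simp only [near, Finset.mem_filter_univ] at ha hb
    have := hammingDist_triangle_left a b x
    omega
  have antipodal_sparse := sparse antipodal fun a ha b hb => by
    simp only [antipodal, Finset.mem_filter_univ] at ha hb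
    have triangle := hammingDist_triangle_right a b xᶜ
    have ha' := hammingDist_add_hammingDist_compl a x
    have hb' := hammingDist_add_hammingDist_compl b x
    rw [Fintype.card_fin, hammingDist_comm _ x] at ha' hb'
    omega
  have neighbors : (middleGraph N t).neighborSet x = ((near ∪ antipodal)ᶜ : Finset _) := by
    ext y
    simp only [SimpleGraph.mem_neighborSet, middleGraph, near, antipodal, Finset.coe_compl,
      Set.mem_compl_iff, Finset.mem_coe, Finset.mem_union, Finset.mem_filter_univ]
    refine ⟨fun h => by omega, fun h => ⟨?_, by omega, by omega⟩⟩
    rintro rfl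
    rw [hammingDist_self] at h
    omega
  have card_union : (#(near ∪ antipodal) : ℝ) ≤ #near + #antipodal :=
    mod_cast Finset.card_union_le _ _
  have card_compl : (#(near ∪ antipodal) : ℝ) + #(near ∪ antipodal)ᶜ = 2 ^ N := by
    exact_mod_cast (Finset.card_add_card_compl (near ∪ antipodal)).trans (by simp)
  rw [neighbors, Set.ncard_coe_finset]
  linarith

end DiscreteCube

section Cycle

theorem card_le_of_forall_sub_lt {S : Finset ℤ} {d : ℕ}
    (hS : ∀ a ∈ S, ∀ b ∈ S, b - a < d) : #S ≤ d := by
  rcases S.eq_empty_or_nonempty with rfl | hne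
  · exact Nat.zero_le d
  · calc #S ≤ #(Finset.Ico (S.min' hne) (S.min' hne + d)) := by
          refine Finset.card_le_card fun b hb => Finset.mem_Ico.mpr ⟨S.min'_le b hb, ?_⟩
          linarith [hS _ (S.min'_mem hne) b hb]
      _ = d := by simp

/-- The graph on the cycle of length `n` whose edges join points at distance at least `d`. -/
def cycleFarGraph (n d : ℕ) : SimpleGraph (ZMod n) where
  Adj i j := i ≠ j ∧ d ≤ (i - j).valMinAbs.natAbs
  symm := ⟨fun i j h => ⟨h.1.symm, by rw [← neg_sub, ZMod.natAbs_valMinAbs_neg]; exact h.2⟩⟩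
  loopless := ⟨fun _ h => h.1 rfl⟩

theorem natCast_add_self_zmod (K : ℕ) : (K : ZMod (2 * K)) + K = 0 := by
  rw [← two_mul]
  exact_mod_cast ZMod.natCast_self (2 * K)

/-- The graph on the cycle of length `2 * K` whose edges join points at distance less than `e` from
being antipodal. -/
def cycleOppGraph (K e : ℕ) : SimpleGraph (ZMod (2 * K)) where
  Adj i j := i ≠ j ∧ (i - j - K).valMinAbs.natAbs < e
  symm := ⟨fun i j h => ⟨h.1.symm, by
    have antipodal_comm : j - i - K = -(i - j - K) := by
      linear_combination -natCast_add_self_zmod K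
    rw [antipodal_comm, ZMod.natAbs_valMinAbs_neg]
    exact h.2⟩⟩
  loopless := ⟨fun _ h => h.1 rfl⟩

theorem cycleOppGraph_le_cycleFarGraph {K e : ℕ} (he : 3 * e ≤ K) :
    cycleOppGraph K e ≤ cycleFarGraph (2 * K) (2 * e) := by
  rintro i j ⟨hne, hij⟩
  refine ⟨hne, ?_⟩
  have antipode : (K : ZMod (2 * K)).valMinAbs = K :=
    ZMod.valMinAbs_natCast_of_le_half (by omega)
  have triangle := ZMod.natAbs_valMinAbs_add_le (n := 2 * K) (i - j) (-(i - j - K))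
  rw [← sub_eq_add_neg, sub_sub_cancel, antipode] at triangle
  have neg := ZMod.natAbs_valMinAbs_neg (n := 2 * K) (i - j - K)
  omega

theorem not_adj_of_cycleOppGraph_adj {K e : ℕ} {i j k : ZMod (2 * K)}
    (hij : (cycleOppGraph K e).Adj i j) (hjk : (cycleOppGraph K e).Adj j k) :
    ¬ (cycleFarGraph (2 * K) (2 * e)).Adj i k := by
  rintro ⟨-, hik⟩
  have cancel : i - j - K + (j - k - K) = i - k := by
    linear_combination -natCast_add_self_zmod K
  have triangle := ZMod.natAbs_valMinAbs_add_le (n := 2 * K) (i - j - K) (j - k - K)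
  rw [cancel] at triangle
  have hij' := hij.2
  have hjk' := hjk.2
  omega

theorem indepNum_cycleFarGraph_le {n d : ℕ} (hd : 0 < d) (hn : 3 * d ≤ n) :
    (cycleFarGraph n d).indepNum ≤ d := by
  have : NeZero n := ⟨by omega⟩
  obtain ⟨S, hS, hcard⟩ := (cycleFarGraph n d).exists_isNIndepSet_indepNum
  rw [← hcard]
  rcases S.eq_empty_or_nonempty with rfl | ⟨o, ho⟩
  · exact Nat.zero_le d
  have close {i j} (hi : i ∈ S) (hj : j ∈ S) : (i - j).valMinAbs.natAbs < d := by
    rcases eq_or_ne i j with rfl | hij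
    · simpa using hd
    · by_contra! far
      exact hS hi hj hij ⟨hij, far⟩
  let φ (i : ZMod n) : ℤ := (i - o).valMinAbs
  have φ_injective : Function.Injective φ := fun i j h =>
    sub_left_injective (ZMod.injective_valMinAbs h)
  -- `φ i - φ j` and the signed distance from `j` to `i` agree modulo `n`, and differ by less
  -- than `3 * d`.
  have φ_sub {i j} (hi : i ∈ S) (hj : j ∈ S) : φ i - φ j = (i - j).valMinAbs := by
    have dvd : (n : ℤ) ∣ φ i - φ j - (i - j).valMinAbs := by
      rw [← ZMod.intCast_zmod_eq_zero_iff_dvd]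
      simp [φ]
    have hio := close hi ho
    have hjo := close hj ho
    have hij := close hi hj
    refine sub_eq_zero.mp (Int.eq_zero_of_abs_lt_dvd dvd ?_)
    simp only [φ, abs_lt]
    omega
  rw [← Finset.card_image_of_injective S φ_injective]
  refine card_le_of_forall_sub_lt ?_
  simp only [Finset.forall_mem_image]
  intro i hi j hj
  have := close hj hi
  rw [φ_sub hj hi]
  omega

theorem ncard_neighborSet_cycleOppGraph {K e : ℕ} [NeZero K] (he : 3 * e ≤ K) (i : ZMod (2 * K)) :
    ((cycleOppGraph K e).neighborSet i).ncard = 2 * e - 1 := by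
  have valMinAbs_cast {a : ℤ} (ha : a ∈ Set.Ioo (-e : ℤ) e) : (a : ZMod (2 * K)).valMinAbs = a := by
    obtain ⟨lower, upper⟩ := ha
    rw [ZMod.valMinAbs_spec]
    exact ⟨rfl, by constructor <;> push_cast <;> omega⟩
  have image : (cycleOppGraph K e).neighborSet i =
      (fun a : ℤ => i - K - (a : ZMod (2 * K))) '' Set.Ioo (-e : ℤ) e := by
    ext j
    constructor
    · rintro ⟨-, hij⟩
      refine ⟨(i - j - K).valMinAbs, ⟨by omega, by omega⟩, ?_⟩
      simp only [ZMod.coe_valMinAbs]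
      ring
    · rintro ⟨a, ha, rfl⟩
      refine ⟨fun h => ?_, ?_⟩
      · have a_eq_half : (a : ZMod (2 * K)) = K := by
          linear_combination -natCast_add_self_zmod K + h
        have := congrArg ZMod.valMinAbs a_eq_half
        rw [valMinAbs_cast ha, ZMod.valMinAbs_natCast_of_le_half (by omega)] at this
        have := ha.2
        omega
      · rw [show i - (i - K - (a : ZMod (2 * K))) - K = a by ring, valMinAbs_cast ha]
        have := ha.1
        have := ha.2
        omega
  rw [image, Set.InjOn.ncard_image]
  · rw [← Finset.coe_Ioo, Set.ncard_coe_finset, Int.card_Ioo]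
    omega
  · intro a ha b hb hab
    rw [← valMinAbs_cast ha, ← valMinAbs_cast hb, sub_right_injective hab]

end Cycle

section GraphProducts

variable {V W : Type*}

/-- The tensor (categorical) product of two graphs, whose edges project to edges of both factors. -/
def tensorGraph (G : SimpleGraph V) (H : SimpleGraph W) : SimpleGraph (V × W) where
  Adj p q := G.Adj p.1 q.1 ∧ H.Adj p.2 q.2
  symm := ⟨fun _ _ h => ⟨h.1.symm, h.2.symm⟩⟩
  loopless := ⟨fun _ h => h.1.ne rfl⟩

/-- The join of copies of a graph indexed by `ι`: any two vertices in different copies are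
adjacent. -/
def joinCopies (ι : Type*) (G : SimpleGraph V) : SimpleGraph (ι × V) where
  Adj p q := p.1 ≠ q.1 ∨ G.Adj p.2 q.2
  symm := ⟨fun _ _ h => h.imp Ne.symm SimpleGraph.Adj.symm⟩
  loopless := ⟨fun _ h => h.elim (· rfl) (·.ne rfl)⟩

theorem disjoint_tensorGraph (G₁ G₂ : SimpleGraph V) {H₁ H₂ : SimpleGraph W}
    (hH : Disjoint H₁ H₂) : Disjoint (tensorGraph G₁ H₁) (tensorGraph G₂ H₂) := by
  rw [disjoint_iff_inf_le] at hH ⊢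
  exact fun p q h => hH ⟨h.1.2, h.2.2⟩

theorem ncard_neighborSet_tensorGraph (G : SimpleGraph V) (H : SimpleGraph W)
    (p : V × W) : ((tensorGraph G H).neighborSet p).ncard =
      (G.neighborSet p.1).ncard * (H.neighborSet p.2).ncard :=
  Set.ncard_prod

theorem ncard_neighborSet_joinCopies {ι : Type*} [Fintype ι] [Fintype V] (G : SimpleGraph V)
    (p : ι × V) : ((joinCopies ι G).neighborSet p).ncard =
      (Fintype.card ι - 1) * Fintype.card V + (G.neighborSet p.2).ncard := by
  have split : (joinCopies ι G).neighborSet p =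
      ({p.1}ᶜ ×ˢ Set.univ) ∪ ({p.1} ×ˢ G.neighborSet p.2) := by
    ext q
    simp only [joinCopies, SimpleGraph.mem_neighborSet, Set.mem_union, Set.mem_prod,
      Set.mem_compl_iff, Set.mem_singleton_iff, Set.mem_univ, and_true, eq_comm (a := q.1)]
    tauto
  have disjoint : Disjoint ({p.1}ᶜ ×ˢ (Set.univ : Set V)) ({p.1} ×ˢ G.neighborSet p.2) :=
    Set.disjoint_prod.mpr (Or.inl disjoint_compl_left)
  rw [split, Set.ncard_union_eq disjoint, Set.ncard_prod, Set.ncard_prod, Set.ncard_compl,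
    Set.ncard_singleton, one_mul, Set.ncard_univ, Nat.card_eq_fintype_card,
    Nat.card_eq_fintype_card]

theorem indepNum_joinCopies_le {ι : Type*} [Finite V] (G : SimpleGraph V) :
    (joinCopies ι G).indepNum ≤ G.indepNum := by
  classical
  obtain ⟨S, hS, hcard⟩ := (joinCopies ι G).exists_isNIndepSet_indepNum
  have same_copy {p q} (hp : p ∈ S) (hq : q ∈ S) : p.1 = q.1 := by
    by_contra h
    exact hS hp hq (ne_of_apply_ne Prod.fst h) (Or.inl h)
  have injOn : Set.InjOn Prod.snd (S : Set (ι × V)) :=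
    fun p hp q hq h => Prod.ext (same_copy hp hq) h
  rw [← hcard, ← Finset.card_image_of_injOn injOn]
  refine SimpleGraph.IsIndepSet.card_le_indepNum ?_
  rw [Finset.coe_image]
  rintro _ ⟨p, hp, rfl⟩ _ ⟨q, hq, rfl⟩ hne hadj
  exact hS hp hq (ne_of_apply_ne Prod.snd hne) (Or.inr hadj)

-- The vertices with dense fibres in an independent set of the product are independent in the first
-- factor, as two dense fibres are joined by an edge.
theorem indepNum_tensorGraph_le [Fintype V] [Fintype W] (G : SimpleGraph V)
    {H : SimpleGraph W} {ε : ℝ} (hε : 0 ≤ ε) (hH : JoinsDenseSets H ε) :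
    ((tensorGraph G H).indepNum : ℝ) ≤ (G.indepNum + ε * Fintype.card V) * Fintype.card W := by
  classical
  obtain ⟨T, hT, hcard⟩ := (tensorGraph G H).exists_isNIndepSet_indepNum
  let fiber (v : V) : Finset W := {w | (v, w) ∈ T}
  have card_eq : #T = ∑ v, #(fiber v) := by
    simp only [fiber, Finset.card_filter]
    rw [← Fintype.sum_prod_type' fun v w => if (v, w) ∈ T then 1 else 0]
    simp
  let dense : Finset V := {v | ε * Fintype.card W ≤ #(fiber v)}
  have dense_indep : G.IsIndepSet dense := by
    intro v hv v' hv' _ hadj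
    obtain ⟨w, hw, w', hw', hww'⟩ :=
      hH _ _ ((Finset.mem_filter_univ v).mp hv) ((Finset.mem_filter_univ v').mp hv')
    rw [Finset.mem_filter_univ] at hw hw'
    exact hT hw hw' (ne_of_apply_ne Prod.fst hadj.ne) ⟨hadj, hww'⟩
  have fiber_le (v : V) :
      (#(fiber v) : ℝ) ≤ (if v ∈ dense then (Fintype.card W : ℝ) else 0) + ε * Fintype.card W := by
    split_ifs with hv
    · have := Finset.card_le_univ (fiber v)
      have : (#(fiber v) : ℝ) ≤ Fintype.card W := mod_cast this
      have : 0 ≤ ε * Fintype.card W := by positivity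
      linarith
    · simp only [dense, Finset.mem_filter_univ, not_le] at hv
      linarith
  calc ((tensorGraph G H).indepNum : ℝ) = ∑ v, (#(fiber v) : ℝ) := by
        rw [← hcard, card_eq, Nat.cast_sum]
    _ ≤ ∑ v, ((if v ∈ dense then (Fintype.card W : ℝ) else 0) + ε * Fintype.card W) :=
        Finset.sum_le_sum fun v _ => fiber_le v
    _ = (#dense + ε * Fintype.card V) * Fintype.card W := by
        simp [Finset.sum_add_distrib]
        ring
    _ ≤ _ := by
        gcongr
        exact dense_indep.card_le_indepNum

-- Two edges of a triangle lie in the same summand, and the third edge is then ruled out by the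
-- hypothesis on one of the factors.
theorem not_adj_of_adj_tensorGraph_sup {F O : SimpleGraph V} {D M : SimpleGraph W}
    (hOF : O ≤ F) (hO : ∀ {a b c}, O.Adj a b → O.Adj b c → ¬ F.Adj a c)
    (hD : ∀ {a b c}, D.Adj a b → D.Adj b c → ¬ (D ⊔ M).Adj a c) {x y z : V × W}
    (hxy : (tensorGraph O M ⊔ tensorGraph F D).Adj x y)
    (hyz : (tensorGraph O M ⊔ tensorGraph F D).Adj y z) :
    ¬ (tensorGraph O M ⊔ tensorGraph F D).Adj x z := by
  intro hxz
  have fst_adj {p q : V × W} : (tensorGraph O M ⊔ tensorGraph F D).Adj p q → F.Adj p.1 q.1 :=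
    Or.rec (hOF ·.1) And.left
  have snd_adj {p q : V × W} : (tensorGraph O M ⊔ tensorGraph F D).Adj p q →
      (D ⊔ M).Adj p.2 q.2 :=
    Or.rec (Or.inr ·.2) (Or.inl ·.2)
  rcases id hxy with oxy | fxy <;> rcases id hyz with oyz | fyz
  · exact hO oxy.1 oyz.1 (fst_adj hxz)
  · rcases id hxz with oxz | fxz
    · exact hO oxy.1.symm oxz.1 (fst_adj hyz)
    · exact hD fxz.2 fyz.2.symm (snd_adj hxy)
  · rcases id hxz with oxz | fxz
    · exact hO oxz.1 oyz.1.symm (fst_adj hxy)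
    · exact hD fxy.2.symm fxz.2 (snd_adj hyz)
  · exact hD fxy.2 fyz.2 (snd_adj hxz)

theorem cliqueFree_of_forall_cliqueFreeOn_fiber {ι : Type*} [Fintype ι] {G : SimpleGraph V}
    (f : V → ι) {k : ℕ} (hG : ∀ i, G.CliqueFreeOn (f ⁻¹' {i}) (k + 1)) :
    G.CliqueFree (Fintype.card ι * k + 1) := by
  classical
  intro S hS
  obtain ⟨i, -, hi⟩ := Finset.exists_lt_card_fiber_of_mul_lt_card_of_maps_to
    (s := S) (t := Finset.univ) (f := f) (n := k) (fun _ _ => Finset.mem_univ _)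
    (by rw [hS.card_eq, Finset.card_univ]; exact Nat.lt_succ_self _)
  obtain ⟨T, hTS, hT⟩ := Finset.exists_subset_card_eq hi
  refine hG i (t := T) ?_ ⟨hS.isClique.subset ?_, hT⟩
  · exact fun v hv => (Finset.mem_filter.mp (hTS hv)).2
  · exact fun v hv => (Finset.mem_filter.mp (hTS hv)).1

end GraphProducts

section Template

variable {ℓ K e N t : ℕ}

/-- The red graph of the template, whose vertices are pairs of a point of one of `ℓ` cycles of
length `2 * K` and a point of the cube of dimension `N`. -/
def templateRed (ℓ K e N t : ℕ) : SimpleGraph ((Fin ℓ × ZMod (2 * K)) × (Fin N → Bool)) :=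
  tensorGraph (joinCopies (Fin ℓ) (cycleFarGraph (2 * K) (2 * e))) (nearlyAntipodalGraph N t)

/-- The purple graph of the template; together with `templateRed` it leaves the remaining pairs for
the blue graph. -/
def templatePurple (ℓ K e N t : ℕ) : SimpleGraph ((Fin ℓ × ZMod (2 * K)) × (Fin N → Bool)) :=
  tensorGraph (joinCopies (Fin ℓ) (cycleOppGraph K e)) (middleGraph N t)

theorem disjoint_templateRed_templatePurple (ℓ K e N t : ℕ) :
    Disjoint (templateRed ℓ K e N t) (templatePurple ℓ K e N t) :=
  disjoint_tensorGraph _ _ (disjoint_nearlyAntipodalGraph_middleGraph N t)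

theorem cliqueFree_template (he : 3 * e ≤ K) (ht : 3 * t ≤ N) :
    (templatePurple ℓ K e N t ⊔ templateRed ℓ K e N t).CliqueFree (2 * ℓ + 1) := by
  suffices (templatePurple ℓ K e N t ⊔ templateRed ℓ K e N t).CliqueFree
      (Fintype.card (Fin ℓ) * 2 + 1) by rwa [Fintype.card_fin, mul_comm ℓ] at this
  refine cliqueFree_of_forall_cliqueFreeOn_fiber (fun v => v.1.1) fun i S hSi hS => ?_
  have drop_copy {v w} (hv : v ∈ S) (hw : w ∈ S)
      (hvw : (templatePurple ℓ K e N t ⊔ templateRed ℓ K e N t).Adj v w) :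
      (tensorGraph (cycleOppGraph K e) (middleGraph N t) ⊔
        tensorGraph (cycleFarGraph (2 * K) (2 * e)) (nearlyAntipodalGraph N t)).Adj
        (v.1.2, v.2) (w.1.2, w.2) :=
    have same_copy : v.1.1 = w.1.1 := (hSi hv).trans (hSi hw).symm
    hvw.imp (fun h => ⟨h.1.resolve_left (· same_copy), h.2⟩)
      fun h => ⟨h.1.resolve_left (· same_copy), h.2⟩
  classical
  obtain ⟨x, y, z, hxy, hxz, hyz, rfl⟩ := SimpleGraph.is3Clique_iff.mp hS
  exact not_adj_of_adj_tensorGraph_sup (cycleOppGraph_le_cycleFarGraph he)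
    not_adj_of_cycleOppGraph_adj (not_adj_of_nearlyAntipodalGraph_adj ht)
    (drop_copy (by simp) (by simp) hxy) (drop_copy (by simp) (by simp) hyz)
    (drop_copy (by simp) (by simp) hxz)

theorem indepNum_templateRed_le (he₀ : 0 < e) (he : 3 * e ≤ K) {ε : ℝ}
    (hε : 0 ≤ ε) (hN : JoinsDenseSets (nearlyAntipodalGraph N t) ε) :
    ((templateRed ℓ K e N t).indepNum : ℝ) ≤ (2 * e + ε * (ℓ * (2 * K))) * 2 ^ N := by
  have : NeZero K := ⟨by omega⟩
  have cycles : (joinCopies (Fin ℓ) (cycleFarGraph (2 * K) (2 * e))).indepNum ≤ 2 * e :=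
    (indepNum_joinCopies_le _).trans (indepNum_cycleFarGraph_le (by omega) (by omega))
  calc ((templateRed ℓ K e N t).indepNum : ℝ)
      ≤ ((joinCopies (Fin ℓ) (cycleFarGraph (2 * K) (2 * e))).indepNum +
          ε * Fintype.card (Fin ℓ × ZMod (2 * K))) * Fintype.card (Fin N → Bool) :=
        indepNum_tensorGraph_le _ hε hN
    _ ≤ (2 * e + ε * (ℓ * (2 * K))) * 2 ^ N := by
        simp only [Fintype.card_prod, Fintype.card_fin, ZMod.card, Fintype.card_pi,
          Fintype.card_bool, Finset.prod_const, Finset.card_univ]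
        push_cast
        gcongr
        exact_mod_cast cycles

theorem le_ncard_neighborSet_templatePurple (he₀ : 0 < e) (he : 3 * e ≤ K)
    (ht₀ : 0 < t) (ht : 5 * t ≤ N) {ε : ℝ} (hN : JoinsDenseSets (nearlyAntipodalGraph N t) ε)
    (v : (Fin ℓ × ZMod (2 * K)) × (Fin N → Bool)) :
    ((ℓ - 1) * (2 * K) + (2 * e - 1)) * (1 - 2 * ε) * 2 ^ N ≤
      (((templatePurple ℓ K e N t).neighborSet v).ncard : ℝ) := by
  have : NeZero K := ⟨by omega⟩
  have hℓ : 1 ≤ ℓ := Nat.one_le_of_lt v.1.1.isLt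
  rw [templatePurple, ncard_neighborSet_tensorGraph, ncard_neighborSet_joinCopies,
    ncard_neighborSet_cycleOppGraph he, Fintype.card_fin, ZMod.card, Nat.cast_mul, mul_assoc]
  push_cast [Nat.cast_sub hℓ, Nat.cast_sub (show 1 ≤ 2 * e by omega)]
  have : (1 : ℝ) ≤ ℓ := mod_cast hℓ
  have : (1 : ℝ) ≤ e := mod_cast he₀
  refine mul_le_mul_of_nonneg_left (le_ncard_neighborSet_middleGraph ht₀ ht hN v.2) ?_
  have : 0 ≤ ((ℓ : ℝ) - 1) * (2 * K) := mul_nonneg (by linarith) (by positivity)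
  linarith

end Template

section Blowup

variable {V W : Type*}

/-- The colouring obtained from vertex-disjoint classes, the fibres of `f`, by giving the pairs
between two classes the colour prescribed by `R` (red), `P` (purple) or their complement (blue);
pairs within a class are blue. -/
def RBPColouring.blowup {R P : SimpleGraph V} (hRP : Disjoint R P) (f : W → V) :
    RBPColouring W where
  red := R.comap f
  purple := P.comap f
  blue := (R.comap f ⊔ P.comap f)ᶜ
  disjoint_red_blue := disjoint_compl_right.mono_left le_sup_left
  disjoint_red_purple := by
    rw [disjoint_iff_inf_le] at hRP ⊢
    exact fun _ _ h => hRP h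
  disjoint_blue_purple := disjoint_compl_left.mono_right le_sup_right
  cover := by rw [sup_right_comm, sup_compl_eq_top]

theorem cliqueFree_comap {G : SimpleGraph V} {k : ℕ} (hG : G.CliqueFree k)
    (f : W → V) : (G.comap f).CliqueFree k := by
  classical
  intro S hS
  have injOn : Set.InjOn f S := fun v hv w hw h => by
    by_contra hne
    exact (SimpleGraph.comap_adj.mp (hS.isClique hv hw hne)).ne h
  refine hG (S.image f) ⟨?_, by rw [Finset.card_image_of_injOn injOn, hS.card_eq]⟩
  rw [Finset.coe_image]
  rintro _ ⟨v, hv, rfl⟩ _ ⟨w, hw, rfl⟩ hne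
  exact hS.isClique hv hw (ne_of_apply_ne f hne)

theorem card_le_of_isClique_blowup [Finite V] [Fintype W] [DecidableEq V]
    {R P : SimpleGraph V} (hRP : Disjoint R P) {f : W → V} {k : ℕ}
    (hf : ∀ a, #{w | f w = a} ≤ k) {S : Finset W}
    (hS : ((RBPColouring.blowup hRP f).purple ⊔ (RBPColouring.blowup hRP f).blue).IsClique S) :
    #S ≤ k * R.indepNum := by
  have image_indep : R.IsIndepSet (S.image f) := by
    rw [Finset.coe_image]
    rintro _ ⟨v, hv, rfl⟩ _ ⟨w, hw, rfl⟩ hne red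
    have not_red : Disjoint (RBPColouring.blowup hRP f).red
        ((RBPColouring.blowup hRP f).purple ⊔ (RBPColouring.blowup hRP f).blue) :=
      (RBPColouring.blowup hRP f).disjoint_red_purple.sup_right
        (RBPColouring.blowup hRP f).disjoint_red_blue
    exact disjoint_iff_inf_le.mp not_red ⟨red, hS hv hw (ne_of_apply_ne f hne)⟩
  calc #S ≤ k * #(S.image f) := Finset.card_le_mul_card_image S k fun a _ =>
          (Finset.card_le_card (Finset.filter_subset_filter _ S.subset_univ)).trans (hf a)
    _ ≤ k * R.indepNum := by
        gcongr
        exact image_indep.card_le_indepNum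

theorem sum_ncard_neighborSet [Fintype V] (G : SimpleGraph V) :
    ∑ v, (G.neighborSet v).ncard = 2 * G.edgeSet.ncard := by
  classical
  rw [← SimpleGraph.coe_edgeFinset, Set.ncard_coe_finset, ← G.sum_degrees_eq_twice_card_edges]
  simp only [Set.ncard_eq_toFinset_card', SimpleGraph.degree, SimpleGraph.neighborFinset]

theorem card_mul_le_ncard_edgeSet_comap [Finite V] [Fintype W] [DecidableEq V]
    {G : SimpleGraph V} {d : ℕ} (hd : ∀ a, d ≤ (G.neighborSet a).ncard) {f : W → V} {k : ℕ}
    (hf : ∀ a, k ≤ #{w | f w = a}) :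
    Fintype.card W * (k * d) ≤ 2 * (G.comap f).edgeSet.ncard := by
  classical
  have := Fintype.ofFinite V
  have degree (w : W) : k * d ≤ ((G.comap f).neighborSet w).ncard := by
    calc k * d ≤ k * #(G.neighborFinset (f w)) := by
          gcongr
          rw [← Set.ncard_coe_finset, SimpleGraph.coe_neighborFinset]
          exact hd (f w)
      _ ≤ #{u | f u ∈ G.neighborFinset (f w)} := by
          refine Finset.mul_card_image_le_card_of_maps_to (f := f)
            (fun u hu => (Finset.mem_filter_univ u).mp hu) k fun a ha => (hf a).trans_eq ?_
          rw [Finset.filter_filter]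
          exact congrArg Finset.card (Finset.filter_congr fun u _ =>
            ⟨fun h => ⟨h ▸ ha, h⟩, And.right⟩)
      _ = ((G.comap f).neighborSet w).ncard := by
          rw [← Set.ncard_coe_finset]
          congr 1
          ext u
          simp
  calc Fintype.card W * (k * d) = ∑ _w : W, k * d := by simp
    _ ≤ ∑ w, ((G.comap f).neighborSet w).ncard := Finset.sum_le_sum fun w _ => degree w
    _ = 2 * (G.comap f).edgeSet.ncard := sum_ncard_neighborSet _

theorem exists_balanced_map (V : Type*) [Fintype V] [DecidableEq V] [Nonempty V] (n : ℕ) :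
    ∃ f : Fin n → V, ∀ a, n / Fintype.card V ≤ #{v | f v = a} ∧
      #{v | f v = a} ≤ n / Fintype.card V + 1 := by
  have card_pos : 0 < Fintype.card V := Fintype.card_pos
  let g := Fintype.equivFin V
  refine ⟨fun v => g.symm ⟨v % Fintype.card V, Nat.mod_lt _ card_pos⟩, fun a => ?_⟩
  have fiber : #{v : Fin n | g.symm ⟨v % Fintype.card V, Nat.mod_lt _ card_pos⟩ = a} =
      n.count (· ≡ g a [MOD Fintype.card V]) := by
    rw [Nat.count_eq_card_filter_range, Finset.card_filter, Finset.card_filter, Finset.sum_range]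
    simp [Equiv.symm_apply_eq, Fin.ext_iff, Nat.ModEq, Nat.mod_eq_of_lt]
  rw [fiber, Nat.count_modEq_card _ card_pos]
  split_ifs <;> omega

end Blowup

section Asymptotics

theorem eventually_exists_mem_purpleCounts_of_template {V : Type*} [Fintype V] [Nonempty V]
    {R P : SimpleGraph V} (hRP : Disjoint R P) {s c L δ : ℝ} (hs : (P ⊔ R).CliqueFree ⌈s⌉₊)
    (hc : R.indepNum < c * Fintype.card V)
    (hL : ∀ a, L * Fintype.card V ≤ (P.neighborSet a).ncard) (hδ : 0 < δ) :
    ∀ᶠ n : ℕ in atTop, ∃ m ∈ purpleCounts n s (c * n), (L - δ) * ((n : ℝ) ^ 2 / 2) ≤ m := by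
  classical
  set v := Fintype.card V
  have : 0 < v := Fintype.card_pos
  obtain ⟨d, L_le, hd⟩ : ∃ d : ℕ, L ≤ d / v ∧ ∀ a, d ≤ (P.neighborSet a).ncard :=
    ⟨⌈L * v⌉₊, (le_div_iff₀ (by positivity)).mpr (Nat.le_ceil _), fun a => Nat.ceil_le.mpr (hL a)⟩
  have density : 0 < c - R.indepNum / v := sub_pos.mpr ((div_lt_iff₀ (by positivity)).mpr hc)
  have tendsto : Tendsto (fun n : ℕ => (n : ℝ)) atTop atTop := tendsto_natCast_atTop_atTop
  filter_upwards [(tendsto.const_mul_atTop density).eventually_gt_atTop (R.indepNum : ℝ),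
    (tendsto.const_mul_atTop hδ).eventually_ge_atTop (d : ℝ)] with n n_large_indep n_large_degree
  obtain ⟨f, hf⟩ := exists_balanced_map V n
  have quotient_le : ((n / v : ℕ) : ℝ) ≤ n / v := Nat.cast_div_le
  have le_quotient : (n : ℝ) / v - 1 ≤ (n / v : ℕ) := by
    rw [← Nat.floor_div_eq_div (K := ℝ)]
    exact (Nat.sub_one_lt_floor _).le
  refine ⟨_, ⟨.blowup hRP f, ⟨cliqueFree_comap hs f, fun S hS => ?_⟩, rfl⟩, ?_⟩
  · have small : (n / v + 1) * R.indepNum < ⌈c * n⌉₊ := by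
      rw [Nat.lt_ceil]
      push_cast
      calc ((n / v : ℕ) + 1 : ℝ) * R.indepNum ≤ (n / v + 1) * R.indepNum := by gcongr
        _ = R.indepNum / v * n + R.indepNum := by ring
        _ < c * n := by linarith
    have card_le := card_le_of_isClique_blowup hRP (fun a => (hf a).2) hS.isClique
    exact (card_le.trans_lt small).ne hS.card_eq
  · have edges : (n : ℝ) * ((n / v : ℕ) * d) ≤ 2 * (P.comap f).edgeSet.ncard := by
      have := card_mul_le_ncard_edgeSet_comap hd fun a => (hf a).1
      rw [Fintype.card_fin] at this
      exact_mod_cast this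
    have : (L - δ) * n ^ 2 ≤ n * ((n / v : ℕ) * d) :=
      calc (L - δ) * n ^ 2 ≤ (d / v - δ) * n ^ 2 := by gcongr
        _ = n * (n / v * d - δ * n) := by ring
        _ ≤ n * (n / v * d - d) := by gcongr
        _ = n * ((n / v - 1) * d) := by ring
        _ ≤ n * ((n / v : ℕ) * d) := by gcongr
    change _ ≤ ((P.comap f).edgeSet.ncard : ℝ)
    linarith

theorem exists_joinsDenseSets_nearlyAntipodalGraph {ε : ℝ} (hε : 0 < ε) :
    ∃ t > 0, JoinsDenseSets (nearlyAntipodalGraph (5 * t) t) ε := by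
  obtain ⟨t, ht⟩ := exists_nat_gt (5 / (2 * ε ^ 2))
  have t_pos : (0 : ℝ) < t := ht.trans' (by positivity)
  refine ⟨t, Nat.cast_pos.mp t_pos, joinsDenseSets_nearlyAntipodalGraph (by omega) hε.le ?_⟩
  rw [div_lt_iff₀ (by positivity)] at ht
  push_cast
  nlinarith

theorem exists_fraction_approx {x η : ℝ} (hx : 0 < x) (hx' : x ≤ 1 / 3) (hη : 0 < η) :
    ∃ K e : ℕ, 0 < e ∧ 3 * e ≤ K ∧ e ≤ x * K ∧ (x - η) * (2 * K) ≤ 2 * e - 1 := by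
  obtain ⟨K, hK⟩ := exists_nat_ge (max (1 / x) (3 / (2 * η)))
  obtain ⟨hKx, hKη⟩ := max_le_iff.mp hK
  rw [div_le_iff₀ (by positivity)] at hKx hKη
  have floor_le : (⌊x * K⌋₊ : ℝ) ≤ x * K := Nat.floor_le (by positivity)
  have lt_floor := Nat.lt_floor_add_one (x * K)
  refine ⟨K, ⌊x * K⌋₊, Nat.floor_pos.mpr (by linarith), ?_, floor_le, by linarith⟩
  have : (3 * ⌊x * K⌋₊ : ℝ) ≤ K := by nlinarith [K.cast_nonneg (α := ℝ)]
  exact_mod_cast this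

theorem exists_template_parameters {ℓ : ℕ} (hℓ : 1 ≤ ℓ) {c : ℝ} (hc₀ : 0 < c)
    (hc : c ≤ 1 / (3 * ℓ)) {δ : ℝ} (hδ : 0 < δ) :
    ∃ ε > 0, ∃ K e : ℕ, 0 < e ∧ 3 * e ≤ K ∧ 2 * e + ε * (ℓ * (2 * K)) < c * (ℓ * (2 * K)) ∧
      ((ℓ - 1) / ℓ + c - δ) * (ℓ * (2 * K)) ≤
        ((ℓ - 1) * (2 * K) + (2 * e - 1)) * (1 - 2 * ε) := by
  have ℓ_ge_one : (1 : ℝ) ≤ ℓ := mod_cast hℓ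
  have cℓ_le : c * ℓ ≤ 1 / 3 := by
    rw [le_div_iff₀ (by positivity)] at hc
    linarith
  obtain ⟨ε, hε, hεδ, hεc⟩ : ∃ ε > 0, 5 * ε ≤ δ ∧ 4 * ε ≤ c :=
    ⟨min (δ / 5) (c / 4), by positivity, by linarith [min_le_left (δ / 5) (c / 4)],
      by linarith [min_le_right (δ / 5) (c / 4)]⟩
  have hε₁ : 0 ≤ 1 - 2 * ε := by linarith [le_mul_of_one_le_right hc₀.le ℓ_ge_one]
  -- With `e / K` at most `(c - 2 * ε) * ℓ`, the red-free density `e / (ℓ * K)` stays below `c` by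
  -- more than the error `ε`.
  obtain ⟨K, e, he, heK, upper, lower⟩ := exists_fraction_approx (x := (c - 2 * ε) * ℓ)
    (η := ε * ℓ) (mul_pos (by linarith) (by linarith)) (by nlinarith) (by positivity)
  have K_pos : (0 : ℝ) < K := Nat.cast_pos.mpr (by omega)
  refine ⟨ε, hε, K, e, he, heK, ?_, ?_⟩
  · have : 0 < ε * (ℓ * (2 * K)) := by positivity
    linarith
  · have q_le : ℓ - 1 + c * ℓ ≤ ℓ := by linarith
    calc ((ℓ - 1) / ℓ + c - δ) * (ℓ * (2 * K)) = (ℓ - 1 + c * ℓ - δ * ℓ) * (2 * K) := by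
          field_simp
      _ ≤ (ℓ - 1 + c * ℓ - 5 * ε * ℓ) * (2 * K) := by gcongr
      _ ≤ ((ℓ - 1 + c * ℓ - 3 * ε * ℓ) * (1 - 2 * ε)) * (2 * K) := by
          gcongr
          have : 0 ≤ ε * (ℓ - (ℓ - 1 + c * ℓ)) := mul_nonneg hε.le (sub_nonneg.mpr q_le)
          have : 0 ≤ ε ^ 2 * ℓ := by positivity
          linarith
      _ = ((ℓ - 1) * (2 * K) + ((c - 2 * ε) * ℓ - ε * ℓ) * (2 * K)) * (1 - 2 * ε) := by ring
      _ ≤ ((ℓ - 1) * (2 * K) + (2 * e - 1)) * (1 - 2 * ε) := by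
          gcongr

theorem eventually_exists_mem_purpleCounts {ℓ : ℕ} (hℓ : 1 ≤ ℓ) {c : ℝ} (hc₀ : 0 < c)
    (hc : c ≤ 1 / (3 * ℓ)) {δ : ℝ} (hδ : 0 < δ) :
    ∀ᶠ n : ℕ in atTop, ∃ m ∈ purpleCounts n (2 * ℓ + 1) (c * n),
      ((ℓ - 1) / ℓ + c - δ) * ((n : ℝ) ^ 2 / 2) ≤ m := by
  obtain ⟨ε, hε, K, e, he, heK, indep, degree⟩ :=
    exists_template_parameters hℓ hc₀ hc (half_pos hδ)
  obtain ⟨t, ht, dense⟩ := exists_joinsDenseSets_nearlyAntipodalGraph hε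
  have : NeZero ℓ := ⟨by omega⟩
  have : NeZero K := ⟨by omega⟩
  have card : (Fintype.card ((Fin ℓ × ZMod (2 * K)) × (Fin (5 * t) → Bool)) : ℝ) =
      ℓ * (2 * K) * 2 ^ (5 * t) := by
    simp [ZMod.card]
  have ceil : ⌈(2 * ℓ + 1 : ℝ)⌉₊ = 2 * ℓ + 1 := by exact_mod_cast Nat.ceil_natCast (2 * ℓ + 1)
  have indep_small : ((templateRed ℓ K e (5 * t) t).indepNum : ℝ) <
      c * Fintype.card ((Fin ℓ × ZMod (2 * K)) × (Fin (5 * t) → Bool)) := by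
    rw [card, ← mul_assoc]
    exact (indepNum_templateRed_le he heK hε.le dense).trans_lt (by gcongr)
  have degree_large (v) : ((ℓ - 1) / ℓ + c - δ / 2) *
      Fintype.card ((Fin ℓ × ZMod (2 * K)) × (Fin (5 * t) → Bool)) ≤
        ((templatePurple ℓ K e (5 * t) t).neighborSet v).ncard := by
    refine le_trans ?_ (le_ncard_neighborSet_templatePurple he heK ht le_rfl dense v)
    rw [card, ← mul_assoc]
    gcongr
  have := eventually_exists_mem_purpleCounts_of_template (s := 2 * ℓ + 1)
    (disjoint_templateRed_templatePurple ℓ K e (5 * t) t)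
    (ceil ▸ cliqueFree_template heK (by omega)) indep_small degree_large (half_pos hδ)
  rwa [sub_sub, add_halves] at this

theorem bddAbove_purpleCounts (n : ℕ) (s t : ℝ) : BddAbove (purpleCounts n s t) := by
  refine ⟨Nat.card (Sym2 (Fin n)), ?_⟩
  rintro _ ⟨C, -, rfl⟩
  exact Set.ncard_le_card _

theorem exists_tendsto_zero_add_le {α : Type*} {l : Filter α} {u : α → ℝ} {L : ℝ}
    (hu : ∀ δ > 0, ∀ᶠ x in l, L - δ ≤ u x) :
    ∃ ε : α → ℝ, Tendsto ε l (𝓝 0) ∧ ∀ x, L + ε x ≤ u x := by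
  refine ⟨fun x => min 0 (u x - L), ?_, fun x => by linarith [min_le_right 0 (u x - L)]⟩
  rw [Metric.tendsto_nhds]
  intro δ hδ
  filter_upwards [hu (δ / 2) (half_pos hδ)] with x hx
  rw [Real.dist_0_eq_abs, abs_of_nonpos (min_le_left _ _), neg_lt, lt_min_iff]
  constructor <;> linarith

end Asymptotics

theorem theorem5p1 (ℓ : ℕ) (hℓ : 1 ≤ ℓ) (c : ℝ) (hc0 : 0 < c) (hc : c < 1 / (3 * (ℓ : ℝ))) :
    ∃ ε : ℕ → ℝ, Tendsto ε atTop (𝓝 0) ∧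
      ∀ᶠ n : ℕ in atTop,
        IsGreatest (purpleCounts n (2 * (ℓ : ℝ) + 1) (c * (n : ℝ)))
          (purpleRamsey n (2 * (ℓ : ℝ) + 1) (c * (n : ℝ))) ∧
        (((ℓ : ℝ) - 1) / (ℓ : ℝ) + c + ε n) * ((n : ℝ) ^ 2 / 2) ≤
          (purpleRamsey n (2 * (ℓ : ℝ) + 1) (c * (n : ℝ)) : ℝ) := by
  have bdd (n : ℕ) := bddAbove_purpleCounts n (2 * ℓ + 1) (c * n)
  have lower (δ : ℝ) (hδ : 0 < δ) := eventually_exists_mem_purpleCounts hℓ hc0 hc.le hδ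
  obtain ⟨ε, tendsto, le⟩ := exists_tendsto_zero_add_le
    (u := fun n : ℕ => (purpleRamsey n (2 * ℓ + 1) (c * n) : ℝ) / (n ^ 2 / 2)) fun δ hδ => by
      filter_upwards [lower δ hδ, eventually_gt_atTop 0] with n ⟨m, hm, le_m⟩ n_pos
      rw [le_div_iff₀ (by positivity)]
      exact le_m.trans (Nat.cast_le.mpr (le_csSup (bdd n) hm))
  refine ⟨ε, tendsto, ?_⟩
  filter_upwards [lower 1 one_pos, eventually_gt_atTop 0] with n ⟨m, hm, _⟩ n_pos
  exact ⟨⟨Nat.sSup_mem ⟨m, hm⟩ (bdd n), fun _ hk => le_csSup (bdd n) hk⟩,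
    (le_div_iff₀ (by positivity)).mp (le n)⟩
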